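/- **Conventions.** Topological vector spaces and topological groups are not assumed Hausdorff unless this is said. Let $\mathcal A$ be a class of real topological vector spaces (resp., of abelian topological groups), and let $E_1,\dots,E_n\in\mathcal A$. A *tensor product of $E_1,\dots,E_n$ in $\mathcal A$* is an element $T\in\mathcal A$ together with a continuous $n$-linear (resp., $n$-additive, i.e. additive in each argument) map $\tau\colon E_1\times\cdots\times E_n\to T$ such that for every $F\in\mathcal A$ and every continuous $n$-linear (resp., $n$-additive) map $f\colon E_1\times\cdots\times E_n\to F$ there is a unique continuous linear map (resp., continuous homomorphism) $\widetilde f\colon T\to F$ with $\widetilde f\circ\tau=f$. **Proposition.** Let $n\ge 1$, let $E_1,\dots,E_n$ be real topological vector spaces, let $T:=E_1\otimes_{\mathbb R}\cdots\otimes_{\mathbb R}E_n$ be the algebraic tensor product of the underlying vector spaces, and let $\tau\colon E_1\times\cdots\times E_n\to T$, $\tau(x_1,\dots,x_n):=x_1\otimes\cdots\otimes x_n$. Let $\mathcal B$ be the set of all subsets of $T$ of the form $$\sum_{k\in\mathbb N}\tau(U_{k,1}\times\cdots\times U_{k,n}):=\bigcup_{k\ge 1}\ \sum_{\ell=1}^{k}\tau(U_{\ell,1}\times\cdots\times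 U_{\ell,n}),$$ where, for each $j\in\{1,\dots,n\}$, $(U_{k,j})_{k\ge1}$ is a sequence of balanced zero-neighbourhoods in $E_j$, and the finite sums are sums of sets. Then: (a) $\mathcal B$ is a basis for the filter of zero-neighbourhoods of a topology $\mathcal O$ on $T$ making $T$ a real topological vector space. (b) $\tau\colon E_1\times\cdots\times E_n\to(T,\mathcal O)$ is continuous. (c) $(T,\mathcal O)$, together with $\tau$, is a tensor product of $E_1,\dots,E_n$ in the class of real topological vector spaces. (d) If $E_1,\dots,E_n$ are Hausdorff, then $(T,\mathcal O)$ is Hausdorff and, together with $\tau$, is a tensor product of $E_1,\dots,E_n$ in the class of Hausdorff real topological vector spaces. (e) If $E_1,\dots,E_n$ are Hausdorff, then $(T,\mathcal O)$, considered as an abelian topological group, together with $\tau$, is a tensor product of the abelian topological groups $(E_1,+),\dots,(E_n,+)$ in the class of Hausdorff abelian topological groups. -/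

import Mathlib

open Topology
open scoped Pointwise TensorProduct

universe u v w

/-- Real topological vector spaces (not presumed Hausdorff): addition, negation and scalar
multiplication are continuous. -/
structure IsRealTVS (F : Type v) [AddCommGroup F] [Module ℝ F] [TopologicalSpace F] : Prop where
  isTopologicalAddGroup : IsTopologicalAddGroup F
  continuousSMul : ContinuousSMul ℝ F

/-- The set `∑_{k ∈ ℕ} τ(U_{k,1} × ⋯ × U_{k,n})`, i.e. the union over `k ≥ 1` of the finite
Minkowski sums of the first `k` sets `τ(U_{l,1} × ⋯ × U_{l,n})` (the sequence is indexed
from `0` here). -/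
def tensorSum {n : ℕ} {E : Fin n → Type u} [∀ j, AddCommGroup (E j)] [∀ j, Module ℝ (E j)]
    (U : ℕ → ∀ j, Set (E j)) : Set (⨂[ℝ] j, E j) :=
  ⋃ k : ℕ, ∑ l ∈ Finset.range (k + 1), (PiTensorProduct.tprod ℝ '' Set.pi Set.univ (U l))

/-- The collection of all sets `∑_{k ∈ ℕ} τ(U_{k,1} × ⋯ × U_{k,n})`, where every `U_{k,j}` is a
balanced zero-neighbourhood in `E j`. -/
def tensorBasis {n : ℕ} (E : Fin n → Type u) [∀ j, AddCommGroup (E j)] [∀ j, Module ℝ (E j)]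
    [∀ j, TopologicalSpace (E j)] : Set (Set (⨂[ℝ] j, E j)) :=
  {S | ∃ U : ℕ → ∀ j, Set (E j),
    (∀ k j, U k j ∈ 𝓝 (0 : E j) ∧ Balanced ℝ (U k j)) ∧ S = tensorSum U}

/-- `T` together with the `n`-linear map `τ` is a tensor product of the `E j` in the class of
real topological vector spaces (test spaces range over the universe `w`). -/
structure IsTensorProductTVS {n : ℕ} {E : Fin n → Type u} {T : Type v}
    [∀ j, AddCommGroup (E j)] [∀ j, Module ℝ (E j)] [∀ j, TopologicalSpace (E j)]
    [AddCommGroup T] [Module ℝ T] [TopologicalSpace T]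
    (τ : MultilinearMap ℝ E T) : Prop where
  isRealTVS : IsRealTVS T
  continuous : Continuous τ
  existsUnique_lift : ∀ (F : Type w) [AddCommGroup F] [Module ℝ F] [TopologicalSpace F],
    IsRealTVS F → ∀ f : MultilinearMap ℝ E F, Continuous f →
      ∃! g : T →ₗ[ℝ] F, Continuous g ∧ ∀ x, g (τ x) = f x

/-- `T` together with the `n`-linear map `τ` is a tensor product of the `E j` in the class of
Hausdorff real topological vector spaces (test spaces range over the universe `w`). -/
structure IsTensorProductHausdorffTVS {n : ℕ} {E : Fin n → Type u} {T : Type v}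
    [∀ j, AddCommGroup (E j)] [∀ j, Module ℝ (E j)] [∀ j, TopologicalSpace (E j)]
    [AddCommGroup T] [Module ℝ T] [TopologicalSpace T]
    (τ : MultilinearMap ℝ E T) : Prop where
  isRealTVS : IsRealTVS T
  t2Space : T2Space T
  continuous : Continuous τ
  existsUnique_lift : ∀ (F : Type w) [AddCommGroup F] [Module ℝ F] [TopologicalSpace F],
    IsRealTVS F → T2Space F → ∀ f : MultilinearMap ℝ E F, Continuous f →
      ∃! g : T →ₗ[ℝ] F, Continuous g ∧ ∀ x, g (τ x) = f x

/-- `n`-additive maps: maps which are additive in each argument. -/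
def IsMultiadditive {n : ℕ} {G : Fin n → Type u} {A : Type v}
    [∀ j, AddCommGroup (G j)] [AddCommGroup A] (f : (∀ j, G j) → A) : Prop :=
  ∀ (x : ∀ j, G j) (j : Fin n) (a b : G j),
    f (Function.update x j (a + b)) = f (Function.update x j a) + f (Function.update x j b)

/-- `T` together with the map `τ` is a tensor product of the `G j` in the class of Hausdorff
abelian topological groups (test groups range over the universe `w`). -/
structure IsTensorProductHausdorffAddGroup {n : ℕ} {G : Fin n → Type u} {T : Type v}
    [∀ j, AddCommGroup (G j)] [∀ j, TopologicalSpace (G j)]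
    [AddCommGroup T] [TopologicalSpace T] (τ : (∀ j, G j) → T) : Prop where
  isTopologicalAddGroup : IsTopologicalAddGroup T
  t2Space : T2Space T
  isMultiadditive : IsMultiadditive τ
  continuous : Continuous τ
  existsUnique_lift : ∀ (A : Type w) [AddCommGroup A] [TopologicalSpace A],
    IsTopologicalAddGroup A → T2Space A →
      ∀ f : (∀ j, G j) → A, IsMultiadditive f → Continuous f →
        ∃! g : T →+ A, Continuous g ∧ ∀ x, g (τ x) = f x

/-! Interleaving two sequences of boxes gives `V + V ⊆ S`. Real scalars act through the first
factor, so the sets in `tensorBasis E` are balanced and define a vector topology. The universal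
properties share one argument. For a zero-neighbourhood `W` in the target, choose
zero-neighbourhoods `V k` all of whose finite sums `∑ v l`, `v l ∈ V l`, lie in `W`, and boxes `U k`
that `g ∘ τ` maps into `V k`; then `g` maps `tensorSum U` into `W`. Only additivity of `g` is used,
so this covers group targets too. There, real scalars move between the arguments of a continuous
multiadditive map: rational ones by divisibility, real ones by density and the Hausdorff property.
Hence the map factors through the tensor product over `ℝ`. The Hausdorff property is proved by
induction on the number of factors. If `w ≠ 0` were a sum of tensors with first factors `x l` in
small balanced sets, some nonzero `b` would not be a combination of the `x l` with coefficients in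
`[-1, 1]`. A functional `φ` with `φ b = 1` and `|φ (x l)| ≤ 1` contracts `w` to a tensor of the
other factors that is both near zero and bounded away from it. As `φ` is chosen after the
representation of `w`, it need not be continuous, and no local convexity is needed. -/

/-! ### Algebra of the sets `tensorSum U`. -/

section Basis

variable {n : ℕ} {E : Fin (n + 1) → Type u} [∀ j, AddCommGroup (E j)] [∀ j, Module ℝ (E j)]

/-- Extending a finite family by zeros, the length of the sums in `tensorSum` can be increased. -/
theorem mem_tensorSum_iff_eventually {U : ℕ → ∀ j, Set (E j)} (hU : ∀ k j, (0 : E j) ∈ U k j)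
    {w : ⨂[ℝ] j, E j} :
    w ∈ tensorSum U ↔ ∃ (K : ℕ) (u : ℕ → ∀ j, E j), (∀ l j, u l j ∈ U l j) ∧
      ∀ k ≥ K, w = ∑ l ∈ Finset.range k, PiTensorProduct.tprod ℝ (u l) := by
  simp only [tensorSum, Set.mem_iUnion]
  constructor
  · rintro ⟨k, hk⟩
    obtain ⟨g, hg, rfl⟩ := (Set.mem_finsetSum _ _ _).1 hk
    have hg' : ∀ l, ∃ x : ∀ j, E j, (∀ j, x j ∈ U l j) ∧
        PiTensorProduct.tprod ℝ x = if l < k + 1 then g l else 0 := by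
      intro l
      split_ifs with h
      · obtain ⟨x, hx, h⟩ := hg (Finset.mem_range.2 h)
        exact ⟨x, fun j => hx j (Set.mem_univ j), h⟩
      -- The zero family pads with zero tensors because there is at least one factor.
      · exact ⟨0, fun j => hU l j, MultilinearMap.map_zero _⟩
    choose u hu hug using hg'
    refine ⟨k + 1, u, hu, fun m hm => ?_⟩
    simp only [hug]
    rw [← Finset.sum_filter]
    refine Finset.sum_congr ?_ fun _ _ => rfl
    ext l
    simp only [Finset.mem_filter, Finset.mem_range]
    omega
  · rintro ⟨K, u, hu, h⟩
    refine ⟨K, (Set.mem_finsetSum _ _ _).2 ⟨fun l => PiTensorProduct.tprod ℝ (u l), ?_,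
      (h (K + 1) (Nat.le_succ K)).symm⟩⟩
    intro l _
    exact ⟨u l, fun j _ => hu l j, rfl⟩

theorem mem_tensorSum_iff {U : ℕ → ∀ j, Set (E j)} (hU : ∀ k j, (0 : E j) ∈ U k j)
    {w : ⨂[ℝ] j, E j} :
    w ∈ tensorSum U ↔ ∃ (k : ℕ) (u : ℕ → ∀ j, E j), (∀ l j, u l j ∈ U l j) ∧
      w = ∑ l ∈ Finset.range k, PiTensorProduct.tprod ℝ (u l) := by
  classical
  constructor
  · rw [mem_tensorSum_iff_eventually hU]
    rintro ⟨K, u, hu, h⟩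
    exact ⟨K, u, hu, h K le_rfl⟩
  · rintro ⟨k, u, hu, rfl⟩
    rw [mem_tensorSum_iff_eventually hU]
    refine ⟨k, fun l => if l < k then u l else 0, fun l j => ?_, fun m hm => ?_⟩
    · dsimp only
      split_ifs
      exacts [hu l j, hU l j]
    · rw [← Finset.sum_subset (Finset.range_subset_range.2 hm)]
      · exact Finset.sum_congr rfl fun l hl => by simp only [if_pos (Finset.mem_range.1 hl)]
      · intro l _ hl
        have hl' : ¬ l < k := by simpa using hl
        simp only [if_neg hl', MultilinearMap.map_zero]

theorem tensorSum_mono {U V : ℕ → ∀ j, Set (E j)} (h : ∀ k j, U k j ⊆ V k j) :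
    tensorSum U ⊆ tensorSum V :=
  Set.iUnion_mono fun _ => Set.finsetSum_subset_finsetSum _ _ _ fun l _ =>
    Set.image_mono (Set.pi_mono fun j _ => h l j)

theorem tprod_mem_tensorSum {U : ℕ → ∀ j, Set (E j)} (hU : ∀ k j, (0 : E j) ∈ U k j)
    {x : ∀ j, E j} (hx : ∀ j, x j ∈ U 0 j) : PiTensorProduct.tprod ℝ x ∈ tensorSum U := by
  refine (mem_tensorSum_iff hU).2 ⟨1, fun l => if l = 0 then x else 0, fun l j => ?_, by simp⟩
  dsimp only
  split_ifs with h
  · exact h ▸ hx j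
  · exact hU l j

/-- Interleaving two sequences of boxes. -/
theorem tensorSum_add_subset {U : ℕ → ∀ j, Set (E j)} (hU : ∀ k j, (0 : E j) ∈ U k j) :
    (tensorSum fun l j => U (2 * l) j ∩ U (2 * l + 1) j) +
      (tensorSum fun l j => U (2 * l) j ∩ U (2 * l + 1) j) ⊆ tensorSum U := by
  rintro _ ⟨a, ha, b, hb, rfl⟩
  have h0 : ∀ l j, (0 : E j) ∈ U (2 * l) j ∩ U (2 * l + 1) j := fun l j => ⟨hU _ j, hU _ j⟩
  obtain ⟨K, u, hu, ha⟩ := (mem_tensorSum_iff_eventually h0).1 ha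
  obtain ⟨L, v, hv, hb⟩ := (mem_tensorSum_iff_eventually h0).1 hb
  refine (mem_tensorSum_iff hU).2
    ⟨2 * (K + L), fun l => if l % 2 = 0 then u (l / 2) else v (l / 2), fun l j => ?_, ?_⟩
  · dsimp only
    rcases Nat.mod_two_eq_zero_or_one l with h | h
    · rw [if_pos h]
      convert (hu (l / 2) j).1 using 2
      omega
    · rw [if_neg (by omega)]
      convert (hv (l / 2) j).2 using 2
      omega
  · dsimp only
    rw [ha (K + L) (by omega), hb (K + L) (by omega)]
    generalize K + L = m
    induction m with
    | zero => simp
    | succ m ih =>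
      rw [show 2 * (m + 1) = 2 * m + 1 + 1 by ring, Finset.sum_range_succ, Finset.sum_range_succ,
        Finset.sum_range_succ, Finset.sum_range_succ, ← ih, if_pos (by omega), if_neg (by omega),
        show 2 * m / 2 = m by omega, show (2 * m + 1) / 2 = m by omega]
      abel

/-- Scalar multiplication acts on a sum of elementary tensors through the first factors. -/
theorem smul_tprod_eq_update (a : ℝ) (x : ∀ j, E j) :
    a • PiTensorProduct.tprod ℝ x = PiTensorProduct.tprod ℝ (Function.update x 0 (a • x 0)) := by
  rw [MultilinearMap.map_update_smul, Function.update_eq_self]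

/-- Only the first factor is rescaled; the others need just `V ⊆ U`. Taking `V = U` gives
balancedness, and `V = U ∩ a⁻¹U` gives continuity of `w ↦ a • w` at zero. -/
theorem smul_mem_tensorSum {U V : ℕ → ∀ j, Set (E j)} (hU : ∀ k j, (0 : E j) ∈ U k j)
    (hV : ∀ k j, (0 : E j) ∈ V k j) (a : ℝ) (hVU : ∀ k j, V k j ⊆ U k j)
    (h : ∀ k j, ∀ x ∈ V k j, a • x ∈ U k j) {w : ⨂[ℝ] j, E j} (hw : w ∈ tensorSum V) :
    a • w ∈ tensorSum U := by
  obtain ⟨k, u, hu, rfl⟩ := (mem_tensorSum_iff hV).1 hw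
  refine (mem_tensorSum_iff hU).2
    ⟨k, fun l => Function.update (u l) 0 (a • u l 0), fun l j => ?_, ?_⟩
  · rcases eq_or_ne j 0 with rfl | hj
    · simpa using h l 0 _ (hu l 0)
    · simpa [hj] using hVU l j (hu l j)
  · simp only [Finset.smul_sum, smul_tprod_eq_update]

theorem balanced_tensorSum {U : ℕ → ∀ j, Set (E j)} (hU : ∀ k j, (0 : E j) ∈ U k j)
    (hb : ∀ k j, Balanced ℝ (U k j)) : Balanced ℝ (tensorSum U) := by
  rintro a ha _ ⟨w, hw, rfl⟩
  exact smul_mem_tensorSum hU hU a (fun _ _ => subset_rfl)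
    (fun k j x hx => (hb k j).smul_mem ha hx) hw

end Basis

/-! ### The vector topology on the tensor product. -/

/-- Zero-neighbourhoods absorb points, simultaneously in finitely many spaces. -/
theorem exists_ne_zero_forall_smul_mem {ι : Type*} [Finite ι] {E : ι → Type*}
    [∀ j, AddCommGroup (E j)] [∀ j, Module ℝ (E j)] [∀ j, TopologicalSpace (E j)]
    [∀ j, ContinuousSMul ℝ (E j)] {U : ∀ j, Set (E j)} (hU : ∀ j, U j ∈ 𝓝 (0 : E j))
    (x : ∀ j, E j) : ∃ c : ℝ, c ≠ 0 ∧ ∀ j, c • x j ∈ U j := by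
  have h : ∀ᶠ c : ℝ in 𝓝 0, ∀ j, c • x j ∈ U j := by
    refine Filter.eventually_all.2 fun j => ?_
    have : Filter.Tendsto (fun c : ℝ => c • x j) (𝓝 0) (𝓝 0) :=
      (continuous_id.smul continuous_const).tendsto' _ _ (zero_smul ℝ _)
    exact this (hU j)
  obtain ⟨c, hc, h0⟩ := ((h.filter_mono nhdsWithin_le_nhds).and
    (self_mem_nhdsWithin : {0}ᶜ ∈ 𝓝[≠] (0 : ℝ))).exists
  exact ⟨c, h0, hc⟩

section TensorTopology

variable {n : ℕ} (E : Fin (n + 1) → Type u) [∀ j, AddCommGroup (E j)] [∀ j, Module ℝ (E j)]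
  [∀ j, TopologicalSpace (E j)]

theorem tensorBasis_add {S : Set (⨂[ℝ] j, E j)} (hS : S ∈ tensorBasis E) :
    ∃ V ∈ tensorBasis E, V + V ⊆ S := by
  obtain ⟨U, hU, rfl⟩ := hS
  exact ⟨_, ⟨_, fun k j => ⟨Filter.inter_mem (hU (2 * k) j).1 (hU (2 * k + 1) j).1,
    (hU (2 * k) j).2.inter (hU (2 * k + 1) j).2⟩, rfl⟩,
    tensorSum_add_subset fun k j => mem_of_mem_nhds (hU k j).1⟩

theorem tensorBasis_balanced {S : Set (⨂[ℝ] j, E j)} (hS : S ∈ tensorBasis E) :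
    Balanced ℝ S := by
  obtain ⟨U, hU, rfl⟩ := hS
  exact balanced_tensorSum (fun k j => mem_of_mem_nhds (hU k j).1) fun k j => (hU k j).2

variable [∀ j, ContinuousSMul ℝ (E j)]

theorem tensorBasis_absorbs (w : ⨂[ℝ] j, E j) :
    ∀ S ∈ tensorBasis E, ∀ᶠ a : ℝ in 𝓝 0, a • w ∈ S := by
  induction w using PiTensorProduct.induction_on with
  | smul_tprod r x =>
    rintro _ ⟨U, hU, rfl⟩
    have h0 : ∀ k j, (0 : E j) ∈ U k j := fun k j => mem_of_mem_nhds (hU k j).1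
    obtain ⟨c, hc, hcx⟩ := exists_ne_zero_forall_smul_mem (fun j => (hU 0 j).1) x
    have hmem := tprod_mem_tensorSum h0 hcx
    -- Scaling all `n + 1` factors by `c` multiplies the tensor by `c ^ (n + 1)`; balancedness then
    -- handles every small `a`.
    have hpow : c ^ (n + 1) ≠ 0 := pow_ne_zero _ hc
    have hlim : Filter.Tendsto (fun a : ℝ => ‖a * r * (c ^ (n + 1))⁻¹‖) (𝓝 0) (𝓝 0) :=
      Continuous.tendsto' (by fun_prop) _ _ (by simp)
    filter_upwards [hlim.eventually (ge_mem_nhds zero_lt_one)] with a ha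
    have := (balanced_tensorSum h0 fun k j => (hU k j).2).smul_mem ha hmem
    rw [MultilinearMap.map_smul_univ (PiTensorProduct.tprod ℝ) (fun _ => c) x] at this
    simpa [smul_smul, mul_assoc, hpow] using this
  | add x y hx hy =>
    intro S hS
    obtain ⟨V, hV, hVS⟩ := tensorBasis_add E hS
    filter_upwards [hx V hV, hy V hV] with a hax hay
    rw [smul_add]
    exact hVS (Set.add_mem_add hax hay)

/-- The sets in `tensorBasis E` form a filter basis defining a vector topology. -/
noncomputable def tensorFilterBasis : ModuleFilterBasis ℝ (⨂[ℝ] j, E j) where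
  __ := addGroupFilterBasisOfComm (tensorBasis E)
    ⟨_, fun _ _ => Set.univ, fun _ _ => ⟨Filter.univ_mem, balanced_univ⟩, rfl⟩
    (by
      rintro _ _ ⟨U, hU, rfl⟩ ⟨V, hV, rfl⟩
      exact ⟨_, ⟨fun k j => U k j ∩ V k j, fun k j => ⟨Filter.inter_mem (hU k j).1 (hV k j).1,
        (hU k j).2.inter (hV k j).2⟩, rfl⟩, Set.subset_inter
          (tensorSum_mono fun _ _ => Set.inter_subset_left)
          (tensorSum_mono fun _ _ => Set.inter_subset_right)⟩)
    (by
      rintro _ ⟨U, hU, rfl⟩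
      exact (mem_tensorSum_iff fun k j => mem_of_mem_nhds (hU k j).1).2
        ⟨0, 0, fun k j => mem_of_mem_nhds (hU k j).1, by simp⟩)
    (fun _ hS => tensorBasis_add E hS)
    (fun S hS => ⟨S, hS, fun _ hx => (tensorBasis_balanced E hS).neg_mem_iff.2 hx⟩)
  smul' {S} hS := by
    refine ⟨Metric.closedBall 0 1, Metric.closedBall_mem_nhds _ one_pos, S, hS, ?_⟩
    rintro _ ⟨a, ha, x, hx, rfl⟩
    exact (tensorBasis_balanced E hS).smul_mem (by simpa using ha) hx
  smul_left' a {S} := by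
    rintro ⟨U, hU, rfl⟩
    have hcont : ∀ j, Filter.Tendsto (fun x : E j => a • x) (𝓝 0) (𝓝 0) := fun j =>
      (continuous_const_smul a).tendsto' _ _ (smul_zero a)
    have hV : ∀ k j, (U k j ∩ (fun x => a • x) ⁻¹' U k j) ∈ 𝓝 (0 : E j) := fun k j =>
      Filter.inter_mem (hU k j).1 (hcont j (hU k j).1)
    refine ⟨_, ⟨_, fun k j => ⟨hV k j, (hU k j).2.inter ?_⟩, rfl⟩, fun w hw => ?_⟩
    · rintro b hb _ ⟨x, hx, rfl⟩
      have : a • b • x ∈ U k j := smul_comm a b x ▸ (hU k j).2.smul_mem hb hx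
      exact this
    · exact smul_mem_tensorSum (fun k j => mem_of_mem_nhds (hU k j).1)
        (fun k j => mem_of_mem_nhds (hV k j)) a (fun _ _ => Set.inter_subset_left)
        (fun _ _ _ hx => hx.2) hw
  smul_right' w {S} hS := tensorBasis_absorbs E w S hS

/-- The topology on the algebraic tensor product whose zero-neighbourhoods have `tensorBasis E`
as a basis. -/
@[reducible]
noncomputable def tensorTopology : TopologicalSpace (⨂[ℝ] j, E j) :=
  (tensorFilterBasis E).topology

theorem tensorTopology_hasBasis :
    (@nhds _ (tensorTopology E) (0 : ⨂[ℝ] j, E j)).HasBasis (fun S => S ∈ tensorBasis E) id :=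
  (tensorFilterBasis E).toAddGroupFilterBasis.nhds_zero_hasBasis

theorem tensorTopology_isTopologicalAddGroup :
    @IsTopologicalAddGroup (⨂[ℝ] j, E j) (tensorTopology E) _ :=
  (tensorFilterBasis E).toAddGroupFilterBasis.isTopologicalAddGroup

theorem tensorTopology_continuousSMul :
    @ContinuousSMul ℝ (⨂[ℝ] j, E j) _ _ (tensorTopology E) :=
  (tensorFilterBasis E).continuousSMul

end TensorTopology

/-! ### Continuity criteria at zero. -/

/-- Every zero-neighbourhood contains all finite sums of elements of a suitable sequence of
zero-neighbourhoods. -/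
theorem exists_nhds_zero_seq_sum_mem {A : Type*} [AddCommGroup A] [TopologicalSpace A]
    [ContinuousAdd A] {W : Set A} (hW : W ∈ 𝓝 (0 : A)) :
    ∃ V : ℕ → Set A, (∀ k, V k ∈ 𝓝 (0 : A)) ∧
      ∀ v : ℕ → A, (∀ l, v l ∈ V l) → ∀ K, ∑ l ∈ Finset.range K, v l ∈ W := by
  have half : ∀ S : {S : Set A // S ∈ 𝓝 (0 : A)}, ∃ R : {S : Set A // S ∈ 𝓝 (0 : A)},
      ∀ a ∈ R.1, ∀ b ∈ R.1, a + b ∈ S.1 := by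
    intro S
    obtain ⟨R, hR, h⟩ := exists_nhds_zero_half S.2
    exact ⟨⟨R, hR⟩, h⟩
  choose φ hφ using half
  have key : ∀ (K : ℕ) (S : {S : Set A // S ∈ 𝓝 (0 : A)}) (v : ℕ → A),
      (∀ l, v l ∈ (φ^[l + 1] S).1) → ∑ l ∈ Finset.range K, v l ∈ S.1 := by
    intro K
    induction K with
    | zero => exact fun S _ _ => by simpa using mem_of_mem_nhds S.2
    | succ K ih =>
      intro S v hv
      -- The first term lies in `φ S`, and the shifted tail sums into `φ S` by induction.
      rw [Finset.sum_range_succ']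
      exact hφ S _ (ih (φ S) (fun l => v (l + 1)) fun l => hv (l + 1)) _ (hv 0)
  exact ⟨fun l => (φ^[l + 1] ⟨W, hW⟩).1, fun l => (φ^[l + 1] ⟨W, hW⟩).2,
    fun v hv K => key K ⟨W, hW⟩ v hv⟩

section Pi

variable {ι : Type*} {E : ι → Type*} [∀ j, AddCommGroup (E j)] [∀ j, Module ℝ (E j)]
  [∀ j, TopologicalSpace (E j)] [∀ j, ContinuousSMul ℝ (E j)]

theorem exists_balanced_box_subset {S : Set (∀ j, E j)} (hS : S ∈ 𝓝 (0 : ∀ j, E j)) :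
    ∃ U : ∀ j, Set (E j), (∀ j, U j ∈ 𝓝 (0 : E j) ∧ Balanced ℝ (U j)) ∧
      ∀ x : ∀ j, E j, (∀ j, x j ∈ U j) → x ∈ S := by
  rw [nhds_pi, Filter.mem_pi'] at hS
  obtain ⟨I, t, ht, hts⟩ := hS
  have h : ∀ j, ∃ U : Set (E j), (U ∈ 𝓝 (0 : E j) ∧ Balanced ℝ U) ∧ U ⊆ t j := fun j =>
    (nhds_basis_balanced ℝ (E j)).mem_iff.1 (ht j)
  choose U hU hUt using h
  exact ⟨U, hU, fun x hx => hts fun j _ => hUt j (hx j)⟩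

end Pi

/-- A multilinear map between real topological vector spaces is continuous if it is continuous
at zero. -/
theorem MultilinearMap.continuous_of_continuousAt_zero {ι : Type*} [Fintype ι] {E : ι → Type*}
    [∀ j, AddCommGroup (E j)] [∀ j, Module ℝ (E j)] [∀ j, TopologicalSpace (E j)]
    [∀ j, IsTopologicalAddGroup (E j)] [∀ j, ContinuousSMul ℝ (E j)]
    {F : Type*} [AddCommGroup F] [Module ℝ F] [TopologicalSpace F] [IsTopologicalAddGroup F]
    (f : MultilinearMap ℝ E F) (hf : ContinuousAt f 0) : Continuous f := by
  classical
  rcases isEmpty_or_nonempty ι with hι | hι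
  · exact continuous_of_const fun x y => congrArg f (Subsingleton.elim x y)
  have hf0 : Filter.Tendsto f (𝓝 0) (𝓝 0) := by
    simpa [ContinuousAt] using hf
  rw [continuous_iff_continuousAt]
  intro x
  -- These are the terms of the expansion of `f (x + h)`. For `s ≠ univ` some slot `i` holds `h i`:
  -- the factors `c` that bring the `x j` into the box are compensated there by `(c ^ s.card)⁻¹`.
  have hterm : ∀ s : Finset ι, s ≠ Finset.univ →
      Filter.Tendsto (fun h => f (s.piecewise x h)) (𝓝 0) (𝓝 0) := by
    intro s hs W hW
    obtain ⟨U, hU, hUW⟩ := exists_balanced_box_subset (hf0 hW)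
    obtain ⟨c, hc, hcx⟩ := exists_ne_zero_forall_smul_mem (fun j => (hU j).1) x
    obtain ⟨i, hi⟩ : ∃ i, i ∉ s := by
      simpa [Finset.eq_univ_iff_forall] using hs
    have hlim : ∀ d : ℝ, ∀ j, ∀ᶠ h in 𝓝 (0 : ∀ j, E j), d • h j ∈ U j := by
      intro d j
      have : Filter.Tendsto (fun h : ∀ j, E j => d • h j) (𝓝 0) (𝓝 0) :=
        ((continuous_apply j).const_smul d).tendsto' _ _ (by simp)
      exact this (hU j).1
    change ∀ᶠ h in 𝓝 (0 : ∀ j, E j), f (s.piecewise x h) ∈ W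
    filter_upwards [Filter.eventually_all.2 (hlim 1),
      hlim (c ^ s.card)⁻¹ i] with h h1 h2
    have hmem := hUW (Function.update (s.piecewise (fun j => c • x j) h) i
      ((c ^ s.card)⁻¹ • h i)) (by
        intro j
        rcases eq_or_ne j i with rfl | hj
        · simpa using h2
        · rw [Function.update_of_ne hj]
          by_cases hjs : j ∈ s
          · simpa [hjs] using hcx j
          · simpa [hjs] using h1 j)
    have heq : f (Function.update (s.piecewise (fun j => c • x j) h) i
        ((c ^ s.card)⁻¹ • h i)) = f (s.piecewise x h) := by
      have e1 : h i = s.piecewise (fun j => c • x j) h i := by simp [hi]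
      have e2 : s.piecewise (fun j => c • x j) h =
          s.piecewise (fun j => c • s.piecewise x h j) (s.piecewise x h) := by
        ext j
        by_cases hjs : j ∈ s <;> simp [hjs]
      rw [e1, f.map_update_smul, Function.update_eq_self, e2,
        f.map_piecewise_smul (fun _ => c), Finset.prod_const, smul_smul,
        inv_mul_cancel₀ (pow_ne_zero _ hc), one_smul]
    simpa [heq] using hmem
  have hsum : Filter.Tendsto (fun h => ∑ s : Finset ι, f (s.piecewise x h)) (𝓝 0) (𝓝 (f x)) := by
    have : Filter.Tendsto (fun h => ∑ s : Finset ι, f (s.piecewise x h)) (𝓝 0)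
        (𝓝 (∑ s : Finset ι, if s = Finset.univ then f x else 0)) := by
      refine tendsto_finsetSum _ fun s _ => ?_
      by_cases hs : s = Finset.univ
      · subst hs
        simpa using tendsto_const_nhds
      · simpa [hs] using hterm s hs
    simpa using this
  have hsub : Filter.Tendsto (fun y => y - x) (𝓝 x) (𝓝 0) :=
    (continuous_id.sub continuous_const).tendsto' _ _ (sub_self x)
  refine (hsum.comp hsub).congr fun y => ?_
  simp only [Function.comp_apply]
  rw [← f.map_add_univ, add_sub_cancel]

section TensorTopology

variable {n : ℕ} {E : Fin (n + 1) → Type u} [∀ j, AddCommGroup (E j)] [∀ j, Module ℝ (E j)]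
  [∀ j, TopologicalSpace (E j)] [∀ j, ContinuousSMul ℝ (E j)]

/-- An additive map on the tensor product is continuous if its composition with the universal
multilinear map is continuous at zero. -/
theorem continuous_of_tendsto_comp_tprod {A : Type*} [AddCommGroup A] [TopologicalSpace A]
    [IsTopologicalAddGroup A] (g : (⨂[ℝ] j, E j) →+ A)
    (hg : Filter.Tendsto (fun x : ∀ j, E j => g (PiTensorProduct.tprod ℝ x)) (𝓝 0) (𝓝 0)) :
    @Continuous _ _ (tensorTopology E) _ g := by
  let _ := tensorTopology E
  have := tensorTopology_isTopologicalAddGroup E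
  refine continuous_of_continuousAt_zero g ?_
  rw [ContinuousAt, map_zero, (tensorTopology_hasBasis E).tendsto_left_iff]
  intro W hW
  obtain ⟨V, hV, hVW⟩ := exists_nhds_zero_seq_sum_mem hW
  choose U hU hUV using fun k => exists_balanced_box_subset (hg (hV k))
  refine ⟨_, ⟨U, hU, rfl⟩, fun w hw => ?_⟩
  obtain ⟨K, u, hu, rfl⟩ := (mem_tensorSum_iff fun k j => mem_of_mem_nhds (hU k j).1).1 hw
  rw [map_sum]
  exact hVW (fun l => g (PiTensorProduct.tprod ℝ (u l))) (fun l => hUV l _ (hu l)) K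

theorem tprod_continuous [∀ j, IsTopologicalAddGroup (E j)] :
    @Continuous _ _ _ (tensorTopology E)
      (PiTensorProduct.tprod ℝ : MultilinearMap ℝ E (⨂[ℝ] j, E j)) := by
  let _ := tensorTopology E
  have := tensorTopology_isTopologicalAddGroup E
  refine MultilinearMap.continuous_of_continuousAt_zero _ ?_
  rw [ContinuousAt, MultilinearMap.map_zero, (tensorTopology_hasBasis E).tendsto_right_iff]
  rintro _ ⟨U, hU, rfl⟩
  filter_upwards [Filter.eventually_all.2 fun j =>
    (continuous_apply j).tendsto' (0 : ∀ j, E j) 0 rfl (hU 0 j).1] with x hx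
  exact tprod_mem_tensorSum (fun k j => mem_of_mem_nhds (hU k j).1) hx

end TensorTopology

/-! ### Hausdorff separation. -/

/-- If `b` is not a linear combination of the `v i` with coefficients in `[-1, 1]`, then some linear
functional maps `b` to `1` and all the `v i` into `[-1, 1]`. -/
theorem exists_linearMap_eq_one_abs_le_one {ι F : Type*} [Fintype ι] [AddCommGroup F] [Module ℝ F]
    (v : ι → F) (b : F) (hb : ∀ t : ι → ℝ, (∀ i, |t i| ≤ 1) → ∑ i, t i • v i ≠ b) :
    ∃ φ : F →ₗ[ℝ] ℝ, φ b = 1 ∧ ∀ i, |φ (v i)| ≤ 1 := by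
  classical
  -- With the `ℓ¹` norm on coefficients, each `v i` is the image of a unit vector. Representations
  -- of `b` form a coset of `ker L` of quotient norm at least `1`, and a norming functional there
  -- descends to the range of `L`.
  let L : PiLp 1 (fun _ : ι => ℝ) →ₗ[ℝ] F :=
    Fintype.linearCombination ℝ v ∘ₗ (WithLp.linearEquiv 1 ℝ (ι → ℝ)).toLinearMap
  have hL : ∀ t, L t = ∑ i, t i • v i := fun t => by
    simp [L, Fintype.linearCombination_apply]
  have hLs : ∀ i, L (WithLp.toLp 1 (Pi.single i 1)) = v i := fun i => by
    simp [L]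
  by_cases hr : b ∈ LinearMap.range L
  · obtain ⟨t₀, rfl⟩ := hr
    let q : PiLp 1 (fun _ : ι => ℝ) ⧸ LinearMap.ker L := Submodule.Quotient.mk t₀
    have hq : 1 ≤ ‖q‖ := by
      refine QuotientAddGroup.le_norm_iff.2 fun m hm => ?_
      by_contra! hlt
      refine hb m (fun i => (PiLp.norm_apply_le m i).trans hlt.le) ?_
      rw [← hL, ← sub_eq_zero, ← map_sub]
      exact (Submodule.Quotient.eq _).1 hm
    have hq0 : 0 < ‖q‖ := zero_lt_one.trans_le hq
    obtain ⟨g, hg, hgq⟩ := exists_dual_vector'' ℝ q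
    have hmem : (g.toLinearMap ∘ₗ (LinearMap.ker L).mkQ) ∈ LinearMap.range L.dualMap := by
      rw [LinearMap.range_dualMap_eq_dualAnnihilator_ker, Submodule.mem_dualAnnihilator]
      intro t ht
      have : (LinearMap.ker L).mkQ t = 0 := (Submodule.Quotient.mk_eq_zero _).2 ht
      simp [this]
    obtain ⟨φ, hφ⟩ := hmem
    have hφL : ∀ t, φ (L t) = g (Submodule.Quotient.mk t) := fun t => LinearMap.congr_fun hφ t
    refine ⟨‖q‖⁻¹ • φ, ?_, fun i => ?_⟩
    · rw [LinearMap.smul_apply, hφL, smul_eq_mul]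
      change ‖q‖⁻¹ * g q = 1
      rw [hgq]
      exact inv_mul_cancel₀ hq0.ne'
    · have h1 : |φ (v i)| ≤ 1 := by
        rw [← hLs, hφL]
        refine (g.le_of_opNorm_le hg _).trans ?_
        rw [one_mul]
        refine (Submodule.Quotient.norm_mk_le _ _).trans ?_
        exact (PiLp.norm_single 1 (fun _ : ι => ℝ) i 1).le.trans norm_one.le
      rw [LinearMap.smul_apply, smul_eq_mul, abs_mul, abs_of_pos (inv_pos.2 hq0)]
      exact mul_le_one₀ (inv_le_one_of_one_le₀ hq) (abs_nonneg _) h1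
  · obtain ⟨f, hf, hfL⟩ := Submodule.exists_le_ker_of_notMem hr
    refine ⟨(f b)⁻¹ • f, by simp [hf], fun i => ?_⟩
    have : f (v i) = 0 := hfL ⟨_, hLs i⟩
    simp [this]

section Split

variable {n : ℕ} (E : Fin (n + 1) → Type u) [∀ j, AddCommGroup (E j)] [∀ j, Module ℝ (E j)]

/-- Splitting off the first factor of a tensor product. -/
noncomputable def splitFirst :
    (⨂[ℝ] j, E j) →ₗ[ℝ] E 0 ⊗[ℝ] (⨂[ℝ] j : Fin n, E j.succ) :=
  PiTensorProduct.lift (LinearMap.uncurryLeft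
    ((PiTensorProduct.lift (R := ℝ) (s := fun j : Fin n => E j.succ)).symm.toLinearMap ∘ₗ
      TensorProduct.mk ℝ (E 0) (⨂[ℝ] j : Fin n, E j.succ)))

/-- The inverse of `splitFirst`. -/
noncomputable def joinFirst :
    E 0 ⊗[ℝ] (⨂[ℝ] j : Fin n, E j.succ) →ₗ[ℝ] (⨂[ℝ] j, E j) :=
  TensorProduct.lift ((PiTensorProduct.lift (R := ℝ) (s := fun j : Fin n => E j.succ)).toLinearMap
    ∘ₗ (PiTensorProduct.tprod ℝ : MultilinearMap ℝ E _).curryLeft)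

theorem splitFirst_tprod (x : ∀ j, E j) :
    splitFirst E (PiTensorProduct.tprod ℝ x) =
      x 0 ⊗ₜ[ℝ] PiTensorProduct.tprod ℝ (fun j : Fin n => x j.succ) := by
  simp [splitFirst]
  rfl

theorem splitFirst_injective : Function.Injective (splitFirst E) := by
  have h : joinFirst E ∘ₗ splitFirst E = LinearMap.id := by
    refine PiTensorProduct.ext (MultilinearMap.ext fun x => ?_)
    simp only [LinearMap.compMultilinearMap_apply, LinearMap.comp_apply, splitFirst_tprod,
      LinearMap.id_apply]
    simp only [joinFirst, TensorProduct.lift.tmul, LinearMap.comp_apply, LinearEquiv.coe_coe,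
      PiTensorProduct.lift.tprod, MultilinearMap.curryLeft_apply]
    exact congrArg _ (Fin.cons_self_tail x)
  exact Function.LeftInverse.injective (g := joinFirst E) fun w => LinearMap.congr_fun h w

end Split

section Hausdorff

/-- The coefficients of a nonzero tensor with respect to a basis of the second factor. -/
theorem exists_contraction_eq_sum {F T : Type*} [AddCommGroup F] [Module ℝ F] [AddCommGroup T]
    [Module ℝ T] {w : F ⊗[ℝ] T} (hw : w ≠ 0) :
    ∃ (b : F) (e : T) (K : Submodule ℝ T), b ≠ 0 ∧ FiniteDimensional ℝ K ∧ e ∉ K ∧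
      ∀ φ : F →ₗ[ℝ] ℝ, φ b = 1 →
        TensorProduct.lid ℝ T (LinearMap.rTensor T φ w) - e ∈ K := by
  classical
  let e := Module.Basis.ofVectorSpace ℝ T
  let c := TensorProduct.equivFinsuppOfBasisRight (M := F) e w
  have hc : c ≠ 0 := by simpa [c] using hw
  obtain ⟨i, hi⟩ := Finsupp.ne_iff.1 hc
  have hsum : c.sum (fun i m => m ⊗ₜ[ℝ] e i) = w := by
    rw [← TensorProduct.equivFinsuppOfBasisRight_symm_apply]
    exact LinearEquiv.symm_apply_apply _ _
  -- `i` has nonzero coefficient `b = c i`; `K` is spanned by the other basis vectors occurring in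
  -- `w`.
  refine ⟨c i, e i, Submodule.span ℝ (e '' (c.support.erase i : Finset _)), hi,
    FiniteDimensional.span_of_finite ℝ (Set.Finite.image _ (Finset.finite_toSet _)),
    e.linearIndependent.notMem_span_image (by simp), fun φ hφ => ?_⟩
  rw [← hsum, Finsupp.sum, map_sum, map_sum, ← Finset.add_sum_erase _ _
    (Finsupp.mem_support_iff.2 hi)]
  simp only [LinearMap.rTensor_tmul, TensorProduct.lid_tmul, hφ, one_smul, add_sub_cancel_left]
  exact Submodule.sum_mem _ fun j hj => Submodule.smul_mem _ _
    (Submodule.subset_span ⟨j, hj, rfl⟩)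

/-- Balancedness lets the `v l` absorb coefficients in `[-1, 1]`, as
`exists_linearMap_eq_one_abs_le_one` requires. -/
theorem exists_balanced_seq_sum_ne {F : Type*} [AddCommGroup F] [Module ℝ F] [TopologicalSpace F]
    [IsTopologicalAddGroup F] [ContinuousSMul ℝ F] [T1Space F] {b : F} (hb : b ≠ 0) :
    ∃ V : ℕ → Set F, (∀ k, V k ∈ 𝓝 (0 : F) ∧ Balanced ℝ (V k)) ∧
      ∀ v : ℕ → F, (∀ l, v l ∈ V l) → ∀ K, ∑ l ∈ Finset.range K, v l ≠ b := by
  obtain ⟨V, hV, h⟩ := exists_nhds_zero_seq_sum_mem (isOpen_compl_singleton.mem_nhds hb.symm)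
  choose W hW hWV using fun k => (nhds_basis_balanced ℝ F).mem_iff.1 (hV k)
  exact ⟨W, hW, fun v hv K => h v (fun l => hWV l (hv l)) K⟩

/-- Separating a nonzero tensor from zero by contracting its first factor. -/
theorem exists_tensorBasis_notMem {n : ℕ} {E : Fin (n + 2) → Type u} [∀ j, AddCommGroup (E j)]
    [∀ j, Module ℝ (E j)] [∀ j, TopologicalSpace (E j)] [∀ j, IsTopologicalAddGroup (E j)]
    [∀ j, ContinuousSMul ℝ (E j)] [T1Space (E 0)]
    (hT : @T2Space (⨂[ℝ] j : Fin (n + 1), E j.succ) (tensorTopology fun j => E j.succ))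
    {w : ⨂[ℝ] j, E j} (hw : w ≠ 0) : ∃ S ∈ tensorBasis E, w ∉ S := by
  let _ := tensorTopology fun j : Fin (n + 1) => E j.succ
  have := tensorTopology_isTopologicalAddGroup fun j : Fin (n + 1) => E j.succ
  have := tensorTopology_continuousSMul fun j : Fin (n + 1) => E j.succ
  obtain ⟨b, e, K, hb, hK, he, hφ⟩ := exists_contraction_eq_sum
    ((map_ne_zero_iff (splitFirst E) (splitFirst_injective E)).2 hw)
  -- The finite-dimensional `K` is closed since the remaining tensor product is Hausdorff, so the
  -- complement of `e + K` is a zero-neighbourhood.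
  have hN : {y | y - e ∉ K} ∈ 𝓝 (0 : ⨂[ℝ] j : Fin (n + 1), E j.succ) := by
    refine ((K.closed_of_finiteDimensional.preimage
      (continuous_id.sub continuous_const)).isOpen_compl).mem_nhds ?_
    simpa using he
  obtain ⟨_, ⟨U, hU, rfl⟩, hUN⟩ := (tensorTopology_hasBasis _).mem_iff.1 hN
  obtain ⟨V, hV, hVb⟩ := exists_balanced_seq_sum_ne hb
  have hW : ∀ k j, (Fin.cons (V k) (U k) : ∀ j, Set (E j)) j ∈ 𝓝 (0 : E j) ∧
      Balanced ℝ ((Fin.cons (V k) (U k) : ∀ j, Set (E j)) j) := by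
    intro k j
    refine Fin.cases ?_ (fun j => ?_) j
    · exact hV k
    · exact hU k j
  refine ⟨_, ⟨fun k => Fin.cons (V k) (U k), hW, rfl⟩, fun hmem => ?_⟩
  obtain ⟨m, u, hu, hwu⟩ := (mem_tensorSum_iff fun k j => mem_of_mem_nhds (hW k j).1).1 hmem
  have huV : ∀ l, u l 0 ∈ V l := fun l => hu l 0
  have huU : ∀ l j, u l (Fin.succ j) ∈ U l j := fun l j => hu l j.succ
  obtain ⟨φ, hφb, hφu⟩ := exists_linearMap_eq_one_abs_le_one (fun l : Fin m => u l 0) b (by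
    intro t ht hsum
    refine hVb (fun l => if h : l < m then t ⟨l, h⟩ • u l 0 else 0) (fun l => ?_) m ?_
    · split_ifs with h
      · exact (hV l).2.smul_mem (by simpa using ht ⟨l, h⟩) (huV l)
      · exact mem_of_mem_nhds (hV l).1
    · rw [Finset.sum_range, ← hsum]
      exact Finset.sum_congr rfl fun l _ => by simp)
  -- The contraction of `w` lies in `e + K`; it remains to place it in `tensorSum U`, moving each
  -- scalar `φ (u l 0)` into a balanced set `U l 0`.
  refine hUN ?_ (hφ φ hφb)
  have h0 : ∀ k j, (0 : E (Fin.succ j)) ∈ U k j := fun k j => mem_of_mem_nhds (hU k j).1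
  refine (mem_tensorSum_iff h0).2 ⟨m, fun l => Function.update (fun j => u l (Fin.succ j)) 0
      ((if l < m then φ (u l 0) else 0) • u l (Fin.succ 0)), fun l j => ?_, ?_⟩
  · rcases eq_or_ne j 0 with rfl | hj
    · simp only [Function.update_self]
      refine (hU l 0).2.smul_mem ?_ (huU l 0)
      split_ifs with h
      · exact hφu ⟨l, h⟩
      · simp
    · simpa only [Function.update_of_ne hj] using huU l j
  · rw [hwu, map_sum, map_sum, map_sum]
    refine Finset.sum_congr rfl fun l hl => ?_
    rw [splitFirst_tprod, LinearMap.rTensor_tmul, TensorProduct.lid_tmul]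
    dsimp only
    rw [if_pos (Finset.mem_range.1 hl)]
    exact smul_tprod_eq_update (E := fun j : Fin (n + 1) => E j.succ) _ _

theorem tensorTopology_t2Space : ∀ {n : ℕ} (E : Fin (n + 1) → Type u) [∀ j, AddCommGroup (E j)]
    [∀ j, Module ℝ (E j)] [∀ j, TopologicalSpace (E j)] [∀ j, IsTopologicalAddGroup (E j)]
    [∀ j, ContinuousSMul ℝ (E j)] [∀ j, T2Space (E j)],
    @T2Space (⨂[ℝ] j, E j) (tensorTopology E) := by
  intro n
  induction n with
  | zero =>
    intro E _ _ _ _ _ _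
    let _ := tensorTopology E
    have : Subsingleton (Fin (0 + 1)) := inferInstanceAs (Subsingleton (Fin 1))
    let g := PiTensorProduct.subsingletonEquiv (R := ℝ) (s := E) 0
    have hg : Continuous g :=
      continuous_of_tendsto_comp_tprod (g : (⨂[ℝ] j, E j) →+ E 0) (by
        simpa [g] using (continuous_apply (0 : Fin 1)).tendsto' (0 : ∀ j, E j) 0 rfl)
    exact T2Space.of_injective_continuous g.injective hg
  | succ n ih =>
    intro E _ _ _ _ _ _
    let _ := tensorTopology E
    have := tensorTopology_isTopologicalAddGroup E
    refine IsTopologicalAddGroup.t2Space_of_zero_sep fun w hw => ?_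
    obtain ⟨S, hS, hwS⟩ := exists_tensorBasis_notMem (ih fun j => E j.succ) hw
    exact ⟨S, (tensorTopology_hasBasis E).mem_of_mem hS, hwS⟩

end Hausdorff

/-! ### Multiadditive maps into Hausdorff groups. -/

section Multiadditive

variable {n : ℕ} {G : Fin n → Type u} {A : Type v} [∀ j, AddCommGroup (G j)] [AddCommGroup A]

/-- A multiadditive map as a `ℤ`-multilinear map. -/
def IsMultiadditive.toMultilinearMap {f : (∀ j, G j) → A} (hf : IsMultiadditive f) :
    MultilinearMap ℤ G A where
  toFun := f
  map_update_add' {inst} x j a b := by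
    rw [Subsingleton.elim inst (instDecidableEqFin n)]
    exact hf x j a b
  map_update_smul' {inst} x j c a := by
    obtain rfl : inst = instDecidableEqFin n := Subsingleton.elim _ _
    exact map_zsmul (AddMonoidHom.mk' (fun a => f (Function.update x j a)) (hf x j)) c a

/-- In a continuous multiadditive map between real topological vector spaces and a Hausdorff
group, real scalars can be moved between the arguments. -/
theorem MultilinearMap.map_update_real_smul [∀ j, Module ℝ (G j)] [∀ j, TopologicalSpace (G j)]
    [∀ j, ContinuousSMul ℝ (G j)] [TopologicalSpace A] [T2Space A]
    (f : MultilinearMap ℤ G A) (hf : Continuous f) (x : ∀ j, G j) (i k : Fin n) (t : ℝ) :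
    f (Function.update x i (t • x i)) = f (Function.update x k (t • x k)) := by
  rcases eq_or_ne i k with rfl | hik
  · rfl
  have hc : ∀ j, Continuous fun t : ℝ => f (Function.update x j (t • x j)) := fun j =>
    hf.comp (continuous_const.update j (continuous_id.smul continuous_const))
  refine congrFun (Rat.denseRange_cast.equalizer (hc i) (hc k) (funext fun q => ?_)) t
  have hd : (q.den : ℝ) ≠ 0 := Nat.cast_ne_zero.2 q.den_ne_zero
  have hq : (q : ℝ) = (q.num : ℝ) * (q.den : ℝ)⁻¹ := by
    rw [← div_eq_mul_inv]
    exact Rat.cast_def q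
  -- The right-hand side is symmetric in `a` and `b`: slot `a` absorbs the numerator, and the
  -- denominator cancels in slot `b`.
  have key : ∀ a b : Fin n, a ≠ b → f (Function.update x a ((q : ℝ) • x a)) = q.num • (q.den : ℤ) •
      f (Function.update (Function.update x a ((q.den : ℝ)⁻¹ • x a)) b
        ((q.den : ℝ)⁻¹ • x b)) := by
    intro a b hab
    rw [← f.map_update_smul, Function.update_comm hab, ← f.map_update_smul,
      Function.update_comm hab.symm, ← Int.cast_smul_eq_zsmul ℝ, ← Int.cast_smul_eq_zsmul ℝ,
      Int.cast_natCast, smul_inv_smul₀ hd, smul_smul, ← hq, Function.update_comm hab,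
      Function.update_eq_self]
  simp only [Function.comp_apply]
  rw [key i k hik, key k i hik.symm, Function.update_comm hik]

end Multiadditive

section LiftAddHom

variable {n : ℕ} {E : Fin (n + 1) → Type u} [∀ j, AddCommGroup (E j)] [∀ j, Module ℝ (E j)]
  {A : Type w} [AddCommGroup A]

/-- An additive version of `PiTensorProduct.lift`, for multiadditive maps in which real scalars
can be moved between the arguments. -/
theorem exists_addMonoidHom_comp_tprod (f : MultilinearMap ℤ E A)
    (hf : ∀ (x : ∀ j, E j) (i : Fin (n + 1)) (t : ℝ),
      f (Function.update x i (t • x i)) = f (Function.update x 0 (t • x 0))) :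
    ∃ g : (⨂[ℝ] j, E j) →+ A, ∀ x, g (PiTensorProduct.tprod ℝ x) = f x := by
  -- A formal multiple `r • τ x` is evaluated by putting `r` into slot `0`; `hf` makes this
  -- compatible with scalars from other slots.
  let φ : ℝ × (∀ j, E j) → A := fun p => f (Function.update p.2 0 (p.1 • p.2 0))
  refine ⟨PiTensorProduct.liftAddHom φ ?_ ?_ ?_ ?_ ?_, fun x => ?_⟩
  · intro r x i hi
    refine f.map_coord_zero i ?_
    rcases eq_or_ne i 0 with rfl | h
    · simp [hi]
    · simpa [h] using hi
  · exact fun x => f.map_coord_zero 0 (by simp)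
  · intro inst r x i a b
    obtain rfl : inst = instDecidableEqFin (n + 1) := Subsingleton.elim _ _
    rcases eq_or_ne i 0 with rfl | h
    · simp [φ, smul_add, f.map_update_add]
    · have e := fun v : E i => Function.update_of_ne h.symm v x
      simp only [φ, e]
      simp only [Function.update_comm h, f.map_update_add]
  · intro r r' x
    simp [φ, add_smul, f.map_update_add]
  · intro inst r x i r'
    obtain rfl : inst = instDecidableEqFin (n + 1) := Subsingleton.elim _ _
    rcases eq_or_ne i 0 with rfl | h
    · simp [φ, smul_smul, mul_comm]
    · have := hf (Function.update x 0 (r • x 0)) i r'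
      have e := fun v : E i => Function.update_of_ne h.symm v x
      simp only [φ, e]
      simpa [Function.update_comm h, h, smul_smul] using this
  · change φ (1, x) = f x
    simp [φ]

theorem addMonoidHom_ext_tprod {g g' : (⨂[ℝ] j, E j) →+ A}
    (h : ∀ x, g (PiTensorProduct.tprod ℝ x) = g' (PiTensorProduct.tprod ℝ x)) : g = g' := by
  ext w
  induction w using PiTensorProduct.induction_on with
  | smul_tprod r x => rw [smul_tprod_eq_update, h]
  | add a b ha hb => rw [map_add, map_add, ha, hb]

end LiftAddHom

/-! ### Universal properties and assembly. -/

theorem tprod_existsUnique_lift {n : ℕ} {E : Fin (n + 1) → Type u} [∀ j, AddCommGroup (E j)]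
    [∀ j, Module ℝ (E j)] [∀ j, TopologicalSpace (E j)] [∀ j, ContinuousSMul ℝ (E j)]
    {F : Type w} [AddCommGroup F] [Module ℝ F] [TopologicalSpace F] [IsTopologicalAddGroup F]
    (f : MultilinearMap ℝ E F) (hf : Continuous f) :
    ∃! g : (⨂[ℝ] j, E j) →ₗ[ℝ] F, @Continuous _ _ (tensorTopology E) _ g ∧
      ∀ x, g (PiTensorProduct.tprod ℝ x) = f x := by
  refine ⟨PiTensorProduct.lift f, ⟨?_, fun x => PiTensorProduct.lift.tprod x⟩, fun g hg =>
    PiTensorProduct.lift.unique hg.2⟩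
  refine continuous_of_tendsto_comp_tprod (PiTensorProduct.lift f : (⨂[ℝ] j, E j) →+ F) ?_
  simpa using hf.tendsto' 0 0 f.map_zero

theorem proposition1p1 {n : ℕ} (hn : 1 ≤ n) (E : Fin n → Type u)
    [∀ j, AddCommGroup (E j)] [∀ j, Module ℝ (E j)] [∀ j, TopologicalSpace (E j)]
    (hE : ∀ j, IsRealTVS (E j)) :
    ∃ 𝒪 : TopologicalSpace (⨂[ℝ] j, E j),
      (IsRealTVS (⨂[ℝ] j, E j) ∧
        (𝓝 (0 : ⨂[ℝ] j, E j)).HasBasis (fun S => S ∈ tensorBasis E) id) ∧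
      Continuous (PiTensorProduct.tprod ℝ : MultilinearMap ℝ E (⨂[ℝ] j, E j)) ∧
      IsTensorProductTVS.{u, u, w}
        (PiTensorProduct.tprod ℝ : MultilinearMap ℝ E (⨂[ℝ] j, E j)) ∧
      ((∀ j, T2Space (E j)) →
        T2Space (⨂[ℝ] j, E j) ∧
        IsTensorProductHausdorffTVS.{u, u, w}
          (PiTensorProduct.tprod ℝ : MultilinearMap ℝ E (⨂[ℝ] j, E j))) ∧
      ((∀ j, T2Space (E j)) →
        IsTensorProductHausdorffAddGroup.{u, u, w}
          (PiTensorProduct.tprod ℝ : MultilinearMap ℝ E (⨂[ℝ] j, E j))) := by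
  obtain ⟨n, rfl⟩ := Nat.exists_eq_add_of_le' hn
  have := fun j => (hE j).isTopologicalAddGroup
  have := fun j => (hE j).continuousSMul
  let _ := tensorTopology E
  have hTVS : IsRealTVS (⨂[ℝ] j, E j) :=
    ⟨tensorTopology_isTopologicalAddGroup E, tensorTopology_continuousSMul E⟩
  refine ⟨tensorTopology E, ⟨hTVS, tensorTopology_hasBasis E⟩, tprod_continuous,
    ⟨hTVS, tprod_continuous, fun F _ _ _ hF f hf => ?_⟩, fun hT2 => ?_, fun hT2 => ?_⟩
  · have := hF.isTopologicalAddGroup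
    exact tprod_existsUnique_lift f hf
  · refine ⟨tensorTopology_t2Space E, hTVS, tensorTopology_t2Space E, tprod_continuous,
      fun F _ _ _ hF _ f hf => ?_⟩
    have := hF.isTopologicalAddGroup
    exact tprod_existsUnique_lift f hf
  · refine ⟨hTVS.isTopologicalAddGroup, tensorTopology_t2Space E,
      fun x j a b => MultilinearMap.map_update_add _ x j a b, tprod_continuous,
      fun A _ _ _ _ f hf hfc => ?_⟩
    obtain ⟨g, hg⟩ := exists_addMonoidHom_comp_tprod hf.toMultilinearMap fun x i t =>
      hf.toMultilinearMap.map_update_real_smul hfc x i 0 t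
    refine ⟨g, ⟨continuous_of_tendsto_comp_tprod g ?_, hg⟩, fun g' hg' =>
      addMonoidHom_ext_tprod fun x => (hg'.2 x).trans (hg x).symm⟩
    simp only [hg]
    exact hfc.tendsto' 0 0 hf.toMultilinearMap.map_zero
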